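/- Let $D:\mathbb{C}\to\mathbb{R}$ be the Bloch–Wigner dilogarithm, $D(z)=\log|z|\,\arg(1-z)-\operatorname{Im}\int_0^z\frac{\log(1-t)}{t}\,dt$, extended continuously by $D(0)=D(1)=0$. A cross-ratio structure on a four-point set $\Delta$ is a function $\mathbf{X}$ from the $24$ orderings of $\Delta$ to $\mathbb{C}\setminus\{0,1\}$ such that, for every ordering $(a,b,c,d)$ of $\Delta$, $$\mathbf{X}(a,b,c,d)=\frac{1}{\mathbf{X}(a,b,d,c)},\qquad \mathbf{X}(a,b,c,d)=\frac{1}{1-\mathbf{X}(a,d,b,c)} .$$ Its volume on the ordered simplex $[a,b,c,d]$ is $$\mathcal{D}([a,b,c,d])=D(\mathbf{X}(a,b,c,d))+D(\mathbf{X}(b,a,d,c))+D(\mathbf{X}(c,d,a,b))+D(\mathbf{X}(d,c,b,a)).$$ Theorem. Let $p_1,\dots,p_5$ be five distinct points, and let a cross-ratio structure be given on each of the five four-point subsets of $\{p_1,\dots,p_5\}$; write $(ijkl)=\mathbf{X}(p_i,p_j,p_k,p_l)$. Suppose that whenever $\{i,j,k,l,m\}=\{1,2,3,4,5\}$ the edge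 compatibility conditions $$(ijkl)=(ijkm)(ijml)$$ and the face compatibility conditions $$(ijkl)(ljik)(kjli)=(imkl)(lmik)(kmli)$$ hold. Then $$\mathcal{D}([p_1,p_2,p_3,p_4])-\mathcal{D}([p_1,p_2,p_3,p_5])+\mathcal{D}([p_1,p_2,p_4,p_5])-\mathcal{D}([p_1,p_3,p_4,p_5])+\mathcal{D}([p_2,p_3,p_4,p_5])=0.$$ -/

import Mathlib

/-- The Bloch–Wigner dilogarithm
`D z = log|z| · arg (1 - z) - Im ∫₀ᶻ log (1 - t) / t dt`.
The integral is taken along the segment `t = s z`, `0 ≤ s ≤ 1` (so `dt / t = ds / s`), with the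
principal branches of `arg` and `log`. On the cut `1 < z` one has `arg (1 - z) = π` and
`Im ∫ = π log z`, so the formula gives the continuous value `0` there too; the junk value
`Real.log 0 = 0` gives `D 0 = 0`. -/
noncomputable def blochWigner (z : ℂ) : ℝ :=
  Real.log ‖z‖ * Complex.arg (1 - z) -
    (∫ s in (0 : ℝ)..1, Complex.log (1 - (s : ℂ) * z) / (s : ℂ)).im

/-- `[a, b, c, d]` is an ordering of the four-point set `Δ`. -/
def IsOrderingOf {P : Type*} (Δ : Set P) (a b c d : P) : Prop :=
  [a, b, c, d].Nodup ∧ Δ = {a, b, c, d}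

/-- `X` restricts to a cross-ratio structure on the four-point set `Δ`: on the 24 orderings of `Δ`
it takes values in `ℂ \ {0, 1}` and satisfies the inversion and similarity relations. Values of `X`
at quadruples that are not orderings of `Δ` play no role. -/
structure IsCrossRatioStructure {P : Type*} (Δ : Set P) (X : P → P → P → P → ℂ) : Prop where
  ne_zero : ∀ a b c d, IsOrderingOf Δ a b c d → X a b c d ≠ 0
  ne_one : ∀ a b c d, IsOrderingOf Δ a b c d → X a b c d ≠ 1
  inversion : ∀ a b c d, IsOrderingOf Δ a b c d → X a b c d = 1 / X a b d c
  similarity : ∀ a b c d, IsOrderingOf Δ a b c d → X a b c d = 1 / (1 - X a d b c)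

/-- Edge compatibility for five points: `(ijkl) = (ijkm)(ijml)`. -/
def EdgeCompatible {P : Type*} (p : Fin 5 → P) (X : P → P → P → P → ℂ) : Prop :=
  ∀ i j k l m : Fin 5, [i, j, k, l, m].Nodup →
    X (p i) (p j) (p k) (p l) = X (p i) (p j) (p k) (p m) * X (p i) (p j) (p m) (p l)

/-- Face compatibility for five points: `(ijkl)(ljik)(kjli) = (imkl)(lmik)(kmli)`. -/
def FaceCompatible {P : Type*} (p : Fin 5 → P) (X : P → P → P → P → ℂ) : Prop :=
  ∀ i j k l m : Fin 5, [i, j, k, l, m].Nodup →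
    X (p i) (p j) (p k) (p l) * X (p l) (p j) (p i) (p k) * X (p k) (p j) (p l) (p i) =
      X (p i) (p m) (p k) (p l) * X (p l) (p m) (p i) (p k) * X (p k) (p m) (p l) (p i)

/-- The volume `𝒟([a, b, c, d]) = D(z₁₂) + D(z₂₁) + D(z₃₄) + D(z₄₃)` of the simplex `[a, b, c, d]`,
where `z₁₂ = X(a,b,c,d)`, `z₂₁ = X(b,a,d,c)`, `z₃₄ = X(c,d,a,b)`, `z₄₃ = X(d,c,b,a)`. -/
noncomputable def simplexVolume {P : Type*} (X : P → P → P → P → ℂ) (a b c d : P) : ℝ :=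
  blochWigner (X a b c d) + blochWigner (X b a d c) +
    blochWigner (X c d a b) + blochWigner (X d c b a)

open MeasureTheory Filter Topology

/-! Two layers of five-term relations. Permuting the last three arguments of a cross-ratio changes
`D` only by the sign of the permutation, so the alternating sum of volumes regroups by first vertex.
At a vertex `i`, edge compatibility makes every cross-ratio a rational function of two of them, and
the five-term relation collapses the four terms at `i` to `D (r i)`, where `r i` is the link
cross-ratio (`blochWigner_linkCrossRatio`). What remains is `D r0 - D r1 + D r2 - D r3 + D r4`. Face
compatibility says that link cross-ratios multiply to 1 around a face (`linkCrossRatio_mul_eq_one`);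
this expresses `r0, r1, r2` through `r3, r4`, and the remaining sum is again a five-term expression.

The five-term relation itself (`fiveTerm_eq_zero`) follows from `dD = Im (G dz)`: the five-term sum
has zero differential in `x`, so it is constant in `x`, and it is antisymmetric in `x, y`. -/

/-! ### The dilogarithm integral off the cut -/

lemma one_sub_mul_mem_slitPlane {z : ℂ} (hz : 1 - z ∈ Complex.slitPlane) {s : ℝ}
    (hs : s ∈ Set.Icc (0 : ℝ) 1) : 1 - (s : ℂ) * z ∈ Complex.slitPlane := by
  have h := Complex.starConvex_one_slitPlane hz (a := 1 - s) (b := s) (by linarith [hs.2]) hs.1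
    (by ring)
  convert h using 1
  simp only [Complex.real_smul]
  push_cast
  ring

/-- The singularity at `s = 0` is removable: for `s ≠ 0` the integrand is the slope at `0` of `w ↦
log (1 - w z)`. -/
lemma intervalIntegrable_log_one_sub_mul_div {z : ℂ} (hz : 1 - z ∈ Complex.slitPlane) :
    IntervalIntegrable (fun s : ℝ => Complex.log (1 - (s : ℂ) * z) / (s : ℂ)) volume 0 1 := by
  set f : ℂ → ℂ := fun w => Complex.log (1 - w * z) with hf
  set U : Set ℂ := {w | 1 - w * z ∈ Complex.slitPlane} with hU
  have hUo : IsOpen U := Complex.isOpen_slitPlane.preimage (by fun_prop)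
  have h0 : (0 : ℂ) ∈ U := by simp [hU]
  have hfd : ∀ w ∈ U, DifferentiableAt ℂ f w := fun w hw =>
    DifferentiableAt.clog (by fun_prop) hw
  have hc : ContinuousOn (dslope f 0) U :=
    (continuousOn_dslope (hUo.mem_nhds h0)).2
      ⟨fun w hw => (hfd w hw).continuousAt.continuousWithinAt, hfd 0 h0⟩
  have hi : IntervalIntegrable (fun s : ℝ => dslope f 0 (s : ℂ)) volume 0 1 := by
    apply ContinuousOn.intervalIntegrable
    refine hc.comp Complex.continuous_ofReal.continuousOn ?_
    intro s hs
    rw [Set.uIcc_of_le zero_le_one] at hs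
    exact one_sub_mul_mem_slitPlane hz hs
  refine (intervalIntegrable_congr ?_).1 hi
  intro s hs
  rw [Set.uIoc_of_le zero_le_one] at hs
  have hs0 : (s : ℂ) ≠ 0 := by exact_mod_cast hs.1.ne'
  change dslope f 0 (s : ℂ) = _
  rw [dslope_of_ne f hs0, slope_def_field]
  simp [hf]

/-- The derivative of `z ↦ ∫₀ᶻ log (1 - t) / t dt` off the cut `[1, ∞)`. -/
lemma hasDerivAt_integral_log_one_sub {z : ℂ} (hz0 : z ≠ 0) (hz : 1 - z ∈ Complex.slitPlane) :
    HasDerivAt (fun z : ℂ => ∫ s in (0 : ℝ)..1, Complex.log (1 - (s : ℂ) * z) / (s : ℂ))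
      (Complex.log (1 - z) / z) z := by
  have hUo : IsOpen {w : ℂ | 1 - w ∈ Complex.slitPlane} :=
    Complex.isOpen_slitPlane.preimage (by fun_prop)
  obtain ⟨r, hr, hrU⟩ := Metric.nhds_basis_closedBall.mem_iff.1 (hUo.mem_nhds hz)
  have hcont : ContinuousOn (fun q : ℂ × ℝ => -(1 - (q.2 : ℂ) * q.1)⁻¹)
      (Metric.closedBall z r ×ˢ Set.Icc (0 : ℝ) 1) := by
    refine ContinuousOn.neg (ContinuousOn.inv₀ (by fun_prop) ?_)
    rintro ⟨w, s⟩ ⟨hw, hs⟩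
    exact Complex.slitPlane_ne_zero (one_sub_mul_mem_slitPlane (hrU hw) hs)
  obtain ⟨C, hC⟩ := ((isCompact_closedBall z r).prod isCompact_Icc).exists_bound_of_continuousOn
    hcont
  have hF'cont : ContinuousOn (fun s : ℝ => -(1 - (s : ℂ) * z)⁻¹) (Set.uIcc 0 1) := by
    rw [Set.uIcc_of_le zero_le_one]
    refine ContinuousOn.neg (ContinuousOn.inv₀ (by fun_prop) ?_)
    intro s hs
    exact Complex.slitPlane_ne_zero (one_sub_mul_mem_slitPlane hz hs)
  have key := intervalIntegral.hasDerivAt_integral_of_dominated_loc_of_deriv_le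
    (μ := volume) (a := 0) (b := 1)
    (F := fun (z : ℂ) (s : ℝ) => Complex.log (1 - (s : ℂ) * z) / (s : ℂ))
    (F' := fun (z : ℂ) (s : ℝ) => -(1 - (s : ℂ) * z)⁻¹) (x₀ := z) (bound := fun _ => C)
    (Metric.closedBall_mem_nhds z hr)
    (Eventually.of_forall fun w => by
      apply Measurable.aestronglyMeasurable
      exact (Complex.measurable_log.comp (by fun_prop)).div (by fun_prop))
    (intervalIntegrable_log_one_sub_mul_div hz)
    (hF'cont.intervalIntegrable.aestronglyMeasurable_restrict_uIoc)
    (Eventually.of_forall fun s hs w hw => by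
      rw [Set.uIoc_of_le zero_le_one] at hs
      exact hC (w, s) ⟨hw, Set.Ioc_subset_Icc_self hs⟩)
    intervalIntegrable_const
    (Eventually.of_forall fun s hs w hw => by
      rw [Set.uIoc_of_le zero_le_one] at hs
      have hs0 : (s : ℂ) ≠ 0 := by exact_mod_cast hs.1.ne'
      have hm := one_sub_mul_mem_slitPlane (hrU hw) (Set.Ioc_subset_Icc_self hs)
      have h1 : HasDerivAt (fun w : ℂ => 1 - (s : ℂ) * w) (-(s : ℂ)) w := by
        simpa using ((hasDerivAt_id w).const_mul (s : ℂ)).const_sub 1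
      refine ((h1.clog hm).div_const (s : ℂ)).congr_deriv ?_
      have := Complex.slitPlane_ne_zero hm
      field_simp)
  -- The `z`-derivative of the integrand is also the `s`-derivative of `log (1 - s z) / z`.
  have hval : ∫ s in (0 : ℝ)..1, -(1 - (s : ℂ) * z)⁻¹ = Complex.log (1 - z) / z := by
    rw [intervalIntegral.integral_eq_sub_of_hasDerivAt
      (f := fun s : ℝ => Complex.log (1 - (s : ℂ) * z) / z) _ hF'cont.intervalIntegrable]
    · simp
    · intro s hs
      rw [Set.uIcc_of_le zero_le_one] at hs
      have hm := one_sub_mul_mem_slitPlane hz hs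
      have h1 : HasDerivAt (fun w : ℂ => 1 - w * z) (-z) (s : ℂ) := by
        simpa using ((hasDerivAt_id (s : ℂ)).mul_const z).const_sub 1
      refine ((h1.clog hm).div_const z).comp_ofReal.congr_deriv ?_
      have := Complex.slitPlane_ne_zero hm
      field_simp
  rw [← hval]
  exact key.2

/-! ### Vanishing on the real axis -/

lemma blochWigner_ofReal_of_lt_one {r : ℝ} (hr : r < 1) : blochWigner r = 0 := by
  have h : ∫ s in (0 : ℝ)..1, Complex.log (1 - (s : ℂ) * (r : ℂ)) / (s : ℂ) =
      ((∫ s in (0 : ℝ)..1, Real.log (1 - s * r) / s : ℝ) : ℂ) := by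
    rw [← intervalIntegral.integral_ofReal]
    refine intervalIntegral.integral_congr fun s hs => ?_
    rw [Set.uIcc_of_le zero_le_one] at hs
    have : 0 ≤ 1 - s * r := by nlinarith [hs.1, hs.2]
    change Complex.log (1 - (s : ℂ) * (r : ℂ)) / (s : ℂ) = _
    rw [Complex.ofReal_div, Complex.ofReal_log this]
    push_cast
    rfl
  have h2 : Complex.arg (1 - (r : ℂ)) = 0 := by
    rw [show (1 - (r : ℂ)) = ((1 - r : ℝ) : ℂ) by push_cast; rfl]
    exact Complex.arg_ofReal_of_nonneg (by linarith)
  rw [blochWigner, h, h2]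
  simp

lemma intervalIntegrable_ofReal {f : ℝ → ℝ} {a b : ℝ} (h : IntervalIntegrable f volume a b) :
    IntervalIntegrable (fun s => (f s : ℂ)) volume a b :=
  ⟨h.1.ofReal, h.2.ofReal⟩

lemma intervalIntegrable_log_one_sub_mul_div_real {r b : ℝ} (hr : 1 < r) (hb : 1 / r ≤ b) :
    IntervalIntegrable (fun s : ℝ => Real.log (1 - s * r) / s) volume 0 b := by
  have hr0 : 0 < r := by linarith
  have ha : 0 < 1 / (2 * r) := by positivity
  have hab : 1 / (2 * r) ≤ b := by
    refine le_trans ?_ hb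
    gcongr
    linarith
  -- This separates the removable singularity at `0` from the logarithmic one at `1 / r`.
  refine IntervalIntegrable.trans (b := 1 / (2 * r)) ?_ ?_
  · set f : ℝ → ℝ := fun w => Real.log (1 - w * r) with hf
    have hne : ∀ w ∈ Set.Iio (1 / r), 1 - w * r ≠ 0 := by
      intro w hw
      rw [Set.mem_Iio, lt_div_iff₀ hr0] at hw
      linarith
    have hfd : ∀ w ∈ Set.Iio (1 / r), DifferentiableAt ℝ f w := fun w hw =>
      DifferentiableAt.log (by fun_prop) (hne w hw)
    have h0 : (0 : ℝ) ∈ Set.Iio (1 / r) := by simpa using hr0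
    have hc : ContinuousOn (dslope f 0) (Set.Iio (1 / r)) :=
      (continuousOn_dslope (isOpen_Iio.mem_nhds h0)).2
        ⟨fun w hw => (hfd w hw).continuousAt.continuousWithinAt, hfd 0 h0⟩
    have hi : IntervalIntegrable (dslope f 0) volume 0 (1 / (2 * r)) := by
      apply ContinuousOn.intervalIntegrable
      refine hc.mono ?_
      intro s hs
      rw [Set.uIcc_of_le ha.le] at hs
      refine lt_of_le_of_lt hs.2 ?_
      gcongr
      linarith
    refine (intervalIntegrable_congr ?_).1 hi
    intro s hs
    rw [Set.uIoc_of_le ha.le] at hs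
    rw [dslope_of_ne f hs.1.ne', slope_def_field]
    simp [hf]
  · have h1 : IntervalIntegrable (fun s : ℝ => Real.log (1 - s * r)) volume (1 / (2 * r)) b := by
      have h := (intervalIntegral.intervalIntegrable_log'
        (a := 1 - 1 / (2 * r) * r) (b := 1 - b * r)).comp_sub_left 1
      have h' := h.comp_mul_right (c := r)
      simpa [hr0.ne'] using h'
    simp only [div_eq_mul_inv (Real.log _)]
    refine h1.mul_continuousOn (continuousOn_id.inv₀ ?_)
    intro s hs
    rw [Set.uIcc_of_le hab] at hs
    exact (lt_of_lt_of_le ha hs.1).ne'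

/-- Past `s = 1 / r` the principal logarithm gains `iπ`; this contributes `π ∫ ds / s = π log r`,
which cancels `log r * arg (1 - r)`. -/
lemma blochWigner_ofReal_of_one_lt {r : ℝ} (hr : 1 < r) : blochWigner r = 0 := by
  have hr0 : 0 < r := by linarith
  have hr1 : 1 / r ≤ 1 := by rw [div_le_one hr0]; exact hr.le
  have hr2 : 0 < 1 / r := by positivity
  set g : ℝ → ℝ := fun s => Real.log (1 - s * r) / s with hg
  have i1 : IntervalIntegrable g volume 0 (1 / r) :=
    intervalIntegrable_log_one_sub_mul_div_real hr le_rfl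
  have i2 : IntervalIntegrable g volume (1 / r) 1 :=
    i1.symm.trans (intervalIntegrable_log_one_sub_mul_div_real hr hr1)
  have i3 : IntervalIntegrable (fun s : ℝ => Real.pi * s⁻¹) volume (1 / r) 1 := by
    refine ContinuousOn.intervalIntegrable (continuousOn_const.mul (continuousOn_id.inv₀ ?_))
    intro s hs
    rw [Set.uIcc_of_le hr1] at hs
    exact (lt_of_lt_of_le hr2 hs.1).ne'
  set F : ℝ → ℂ := fun s => Complex.log (1 - (s : ℂ) * (r : ℂ)) / (s : ℂ) with hF
  have e1 : Set.EqOn (fun s => ((g s : ℝ) : ℂ)) F (Set.uIoc 0 (1 / r)) := by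
    intro s hs
    rw [Set.uIoc_of_le hr2.le] at hs
    have : 0 ≤ 1 - s * r := by
      have := hs.2
      rw [le_div_iff₀ hr0] at this
      linarith
    simp only [hg, hF]
    rw [Complex.ofReal_div, Complex.ofReal_log this]
    push_cast
    rfl
  have e2 : Set.EqOn (fun s => ((g s : ℝ) : ℂ) + ((Real.pi * s⁻¹ : ℝ) : ℂ) * Complex.I) F
      (Set.uIoc (1 / r) 1) := by
    intro s hs
    rw [Set.uIoc_of_le hr1] at hs
    have hneg : 1 - s * r < 0 := by
      have := hs.1
      rw [div_lt_iff₀ hr0] at this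
      linarith
    have hcast : 1 - (s : ℂ) * (r : ℂ) = ((1 - s * r : ℝ) : ℂ) := by push_cast; rfl
    simp only [hg, hF]
    rw [hcast, Complex.log, Complex.arg_ofReal_of_neg hneg, Complex.norm_real, Real.norm_eq_abs,
      Real.log_abs]
    push_cast
    ring
  have j1 : IntervalIntegrable F volume 0 (1 / r) :=
    (intervalIntegrable_congr e1).1 (intervalIntegrable_ofReal i1)
  have j2 : IntervalIntegrable F volume (1 / r) 1 :=
    (intervalIntegrable_congr e2).1 ((intervalIntegrable_ofReal i2).add ((intervalIntegrable_ofReal i3).mul_const Complex.I))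
  have v1 : ∫ s in (0 : ℝ)..(1 / r), F s = ((∫ s in (0 : ℝ)..(1 / r), g s : ℝ) : ℂ) := by
    rw [← intervalIntegral.integral_ofReal]
    exact intervalIntegral.integral_congr_ae (Eventually.of_forall fun s hs => (e1 hs).symm)
  have v2 : ∫ s in (1 / r)..1, F s = ((∫ s in (1 / r)..1, g s : ℝ) : ℂ) +
      ((Real.pi * Real.log r : ℝ) : ℂ) * Complex.I := by
    rw [intervalIntegral.integral_congr_ae (Eventually.of_forall fun s hs => (e2 hs).symm),
      intervalIntegral.integral_add (intervalIntegrable_ofReal i2) ((intervalIntegrable_ofReal i3).mul_const Complex.I),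
      intervalIntegral.integral_mul_const, intervalIntegral.integral_ofReal,
      intervalIntegral.integral_ofReal, intervalIntegral.integral_const_mul,
      integral_inv_of_pos hr2 one_pos]
    simp
  have h2 : Complex.arg (1 - (r : ℂ)) = Real.pi := by
    rw [show (1 - (r : ℂ)) = ((1 - r : ℝ) : ℂ) by push_cast; rfl]
    exact Complex.arg_ofReal_of_neg (by linarith)
  rw [blochWigner, h2, ← intervalIntegral.integral_add_adjacent_intervals j1 j2, v1, v2,
    Complex.norm_real, Real.norm_of_nonneg hr0.le]
  simp only [Complex.add_im, Complex.ofReal_im, Complex.mul_im, Complex.ofReal_re, Complex.I_re,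
    Complex.I_im]
  ring

lemma blochWigner_ofReal {r : ℝ} (hr : r ≠ 1) : blochWigner r = 0 :=
  hr.lt_or_gt.elim blochWigner_ofReal_of_lt_one blochWigner_ofReal_of_one_lt

/-! ### Differentials of the form `Im (G dz)` -/

/-- `f` has real differential `v ↦ Im (G v)` at `z`. -/
def HasImDerivAt (f : ℂ → ℝ) (G z : ℂ) : Prop :=
  HasFDerivAt f (Complex.imCLM.comp (G • (1 : ℂ →L[ℝ] ℂ))) z

namespace HasImDerivAt

variable {f g : ℂ → ℝ} {G H z : ℂ}

lemma add (hf : HasImDerivAt f G z) (hg : HasImDerivAt g H z) :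
    HasImDerivAt (fun w => f w + g w) (G + H) z := by
  refine (HasFDerivAt.add hf hg).congr_fderiv ?_
  ext
  simp
  ring

lemma neg (hf : HasImDerivAt f G z) : HasImDerivAt (fun w => -f w) (-G) z := by
  refine (HasFDerivAt.neg hf).congr_fderiv ?_
  ext
  simp

lemma sub (hf : HasImDerivAt f G z) (hg : HasImDerivAt g H z) :
    HasImDerivAt (fun w => f w - g w) (G - H) z := by
  simpa [sub_eq_add_neg] using hf.add hg.neg

lemma comp {h : ℂ → ℂ} {h' : ℂ} (hf : HasImDerivAt f G (h z)) (hh : HasDerivAt h h' z) :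
    HasImDerivAt (fun w => f (h w)) (G * h') z := by
  refine (HasFDerivAt.comp z hf hh.complexToReal_fderiv).congr_fderiv ?_
  ext
  simp
  ring

lemma congr_deriv (hf : HasImDerivAt f G z) (h : G = H) : HasImDerivAt f H z := h ▸ hf

lemma congr (hf : HasImDerivAt f G z) (h : g =ᶠ[𝓝 z] f) : HasImDerivAt g G z :=
  HasFDerivAt.congr_of_eventuallyEq hf h

lemma eq_of_isPreconnected {U : Set ℂ} (hU : IsOpen U) (hc : IsPreconnected U)
    (hf : ∀ z ∈ U, HasImDerivAt f 0 z) {x y : ℂ} (hx : x ∈ U) (hy : y ∈ U) : f x = f y := by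
  refine hU.is_const_of_fderiv_eq_zero (𝕜 := ℝ) hc
    (fun z hz => (HasFDerivAt.differentiableAt (hf z hz)).differentiableWithinAt) ?_ hx hy
  intro z hz
  rw [HasFDerivAt.fderiv (hf z hz)]
  ext
  simp

lemma eq_of_forall_notMem {s : Set ℂ} (hs : s.Finite) (hf : ∀ z ∉ s, HasImDerivAt f 0 z)
    {x y : ℂ} (hx : x ∉ s) (hy : y ∉ s) : f x = f y := by
  refine eq_of_isPreconnected hs.isClosed.isOpen_compl ?_ hf hx hy
  refine (Set.Countable.isConnected_compl_of_one_lt_rank ?_ hs.countable).isPreconnected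
  rw [Complex.rank_real_complex]
  norm_num

end HasImDerivAt

/-! ### Differential and symmetries of `D` -/

lemma hasFDerivAt_log_norm {z : ℂ} (hz : z ≠ 0) :
    HasFDerivAt (fun w : ℂ => Real.log ‖w‖) (Complex.reCLM.comp (z⁻¹ • (1 : ℂ →L[ℝ] ℂ))) z := by
  -- Dividing by `z` moves the base point to `1`, away from the cut of `log`.
  have h1 : HasDerivAt (fun w : ℂ => Complex.log (w / z)) z⁻¹ z := by
    have := ((hasDerivAt_id z).div_const z).clog (by simp [hz])
    refine this.congr_deriv ?_
    simp [hz]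
  have h2 : HasFDerivAt (fun w : ℂ => (Complex.log (w / z)).re + Real.log ‖z‖)
      (Complex.reCLM.comp (z⁻¹ • (1 : ℂ →L[ℝ] ℂ))) z :=
    (Complex.reCLM.hasFDerivAt.comp z h1.complexToReal_fderiv).add_const _
  refine h2.congr_of_eventuallyEq ?_
  filter_upwards [isOpen_ne.mem_nhds hz] with w hw
  rw [Complex.log_re, norm_div, Real.log_div (by simpa using hw) (by simpa using hz)]
  ring

/-- The coefficient `G` of the differential `dD = Im (G dz)` of the Bloch–Wigner function. -/
noncomputable def blochWignerDeriv (z : ℂ) : ℂ :=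
  -(Real.log ‖z‖ : ℂ) / (1 - z) - (Real.log ‖1 - z‖ : ℂ) / z

/-- The two terms `arg (1 - z) * Re (dz / z)` cancel, so only logarithms of norms survive. -/
lemma hasImDerivAt_blochWigner_of_mem_slitPlane {z : ℂ} (hz0 : z ≠ 0)
    (hz : 1 - z ∈ Complex.slitPlane) : HasImDerivAt blochWigner (blochWignerDeriv z) z := by
  have h1 : HasDerivAt (fun w : ℂ => Complex.log (1 - w)) (-1 / (1 - z)) z :=
    ((hasDerivAt_id z).const_sub 1).clog hz
  have h1' := Complex.imCLM.hasFDerivAt.comp z h1.complexToReal_fderiv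
  have h2' := Complex.imCLM.hasFDerivAt.comp z
    (hasDerivAt_integral_log_one_sub hz0 hz).complexToReal_fderiv
  have h3 := ((hasFDerivAt_log_norm hz0).mul h1').sub h2'
  refine HasFDerivAt.congr_fderiv (f := blochWigner) (h3.congr_of_eventuallyEq ?_) ?_
  · refine Eventually.of_forall fun w => ?_
    simp [blochWigner, Complex.log_im]
  · have h1z := Complex.slitPlane_ne_zero hz
    have key : ∀ v : ℂ, Real.log ‖z‖ * (-1 / (1 - z) * v).im
        + (Complex.log (1 - z)).im * (z⁻¹ * v).re - (Complex.log (1 - z) / z * v).im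
        = (blochWignerDeriv z * v).im := by
      intro v
      have e1 : Complex.log (1 - z) / z * v = Complex.log (1 - z) * (z⁻¹ * v) := by
        field_simp
      have e2 : blochWignerDeriv z * v = (Real.log ‖z‖ : ℂ) * (-1 / (1 - z) * v)
          - (Real.log ‖1 - z‖ : ℂ) * (z⁻¹ * v) := by
        rw [blochWignerDeriv]
        field_simp
      rw [e1, e2, Complex.sub_im, Complex.im_ofReal_mul, Complex.im_ofReal_mul,
        Complex.mul_im (Complex.log (1 - z)), Complex.log_re]
      ring
    ext v
    simpa using key v

lemma blochWigner_eq_zero_of_im_eq_zero {z : ℂ} (hz : z.im = 0) (h1 : z ≠ 1) : blochWigner z = 0 := by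
  obtain ⟨r, rfl⟩ : ∃ r : ℝ, z = r := ⟨z.re, Complex.ext (by simp) (by simpa using hz)⟩
  exact blochWigner_ofReal (by exact_mod_cast h1)

lemma hasDerivAt_one_div {z : ℂ} (hz : z ≠ 0) : HasDerivAt (fun w : ℂ => 1 / w) (-1 / z ^ 2) z := by
  simpa [neg_div] using hasDerivAt_inv hz

lemma blochWignerDeriv_one_div {z : ℂ} (h0 : z ≠ 0) (h1 : z ≠ 1) :
    blochWignerDeriv (1 / z) * (-1 / z ^ 2) = -blochWignerDeriv z := by
  have h1' : 1 - z ≠ 0 := sub_ne_zero.2 h1.symm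
  have h1'' : z - 1 ≠ 0 := sub_ne_zero.2 h1
  have e : 1 - 1 / z = -((1 - z) / z) := by field_simp; ring
  have e' : ‖1 - 1 / z‖ = ‖1 - z‖ / ‖z‖ := by rw [e, norm_neg, norm_div]
  rw [blochWignerDeriv, blochWignerDeriv, e', e, norm_div, norm_one, one_div, Real.log_inv,
    Real.log_div (by simpa using h1') (by simpa using h0)]
  push_cast
  field_simp
  ring

lemma blochWigner_one_div {z : ℂ} (h1 : z ≠ 1) :
    blochWigner (1 / z) = -blochWigner z := by
  by_cases him : z.im = 0
  · rw [blochWigner_eq_zero_of_im_eq_zero him h1, blochWigner_eq_zero_of_im_eq_zero, neg_zero]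
    · simp [Complex.inv_im, him]
    · simpa using h1
  -- `U` is the plane without `[0, ∞)`: it is connected, and there both `w` and `1 / w` avoid the
  -- cut `[1, ∞)`.
  set U : Set ℂ := {w | -w ∈ Complex.slitPlane} with hU
  have hUo : IsOpen U := Complex.isOpen_slitPlane.preimage continuous_neg
  have hUc : IsPreconnected U := by
    have h := (Complex.starConvex_one_slitPlane.isPathConnected
      (by simp)).isConnected.isPreconnected.image _ continuous_neg.continuousOn
    rwa [Set.image_neg_eq_neg] at h
  have hne : ∀ w ∈ U, w ≠ 0 ∧ 1 - w ∈ Complex.slitPlane ∧ 1 - 1 / w ∈ Complex.slitPlane := by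
    intro w hw
    have hw0 : w ≠ 0 := by simpa using Complex.slitPlane_ne_zero hw
    have hw' : w.re < 0 ∨ w.im ≠ 0 := by simpa [hU, Complex.mem_slitPlane_iff] using hw
    have hn : 0 < Complex.normSq w := Complex.normSq_pos.2 hw0
    refine ⟨hw0, ?_, ?_⟩
    · rw [Complex.mem_slitPlane_iff]
      rcases hw' with h | h
      · left
        simp only [Complex.sub_re, Complex.one_re]
        linarith
      · right
        simpa using h
    · rw [Complex.mem_slitPlane_iff]
      rcases hw' with h | h
      · left
        simp only [Complex.sub_re, Complex.one_re, one_div, Complex.inv_re]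
        have := div_neg_of_neg_of_pos h hn
        linarith
      · right
        simp [Complex.inv_im, h, hw0]
  have hconst := HasImDerivAt.eq_of_isPreconnected (f := fun w => blochWigner (1 / w) + blochWigner w)
    hUo hUc (fun w hw => by
      obtain ⟨hw0, hw1, hw2⟩ := hne w hw
      have hw1' : w ≠ 1 := (sub_ne_zero.1 (Complex.slitPlane_ne_zero hw1)).symm
      refine (((hasImDerivAt_blochWigner_of_mem_slitPlane (one_div_ne_zero hw0) hw2).comp
        (hasDerivAt_one_div hw0)).add
        (hasImDerivAt_blochWigner_of_mem_slitPlane hw0 hw1)).congr_deriv ?_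
      rw [blochWignerDeriv_one_div hw0 hw1', neg_add_cancel])
    (x := z) (y := -1)
    (by rw [hU, Set.mem_ofPred_eq, Complex.mem_slitPlane_iff]; right; simpa using him)
    (by simp [hU])
  have hm1 : blochWigner (-1) = 0 := blochWigner_eq_zero_of_im_eq_zero (by simp) (by norm_num)
  norm_num [hm1] at hconst
  rw [one_div]
  linarith

/-- Inversion carries the cut `(1, ∞)` into `(0, 1)`, where the differential is already known. -/
lemma hasImDerivAt_blochWigner {z : ℂ} (h0 : z ≠ 0) (h1 : z ≠ 1) :
    HasImDerivAt blochWigner (blochWignerDeriv z) z := by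
  by_cases hz : 1 - z ∈ Complex.slitPlane
  · exact hasImDerivAt_blochWigner_of_mem_slitPlane h0 hz
  have hz' : 1 - 1 / z ∈ Complex.slitPlane := by
    rw [Complex.mem_slitPlane_iff] at hz ⊢
    push Not at hz
    simp only [Complex.sub_re, Complex.one_re, Complex.sub_im, Complex.one_im, zero_sub,
      neg_eq_zero] at hz
    obtain ⟨r, rfl⟩ : ∃ r : ℝ, z = r := ⟨z.re, Complex.ext (by simp) (by simpa using hz.2)⟩
    have hr : 1 < r := lt_of_le_of_ne (by simpa using hz.1) (by exact_mod_cast h1.symm)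
    left
    rw [← Complex.ofReal_one, ← Complex.ofReal_div, ← Complex.ofReal_sub, Complex.ofReal_re,
      sub_pos, div_lt_one (by linarith)]
    exact hr
  have h := ((hasImDerivAt_blochWigner_of_mem_slitPlane (one_div_ne_zero h0) hz').comp
    (hasDerivAt_one_div h0)).neg
  rw [blochWignerDeriv_one_div h0 h1, neg_neg] at h
  refine h.congr ?_
  filter_upwards [isOpen_ne.mem_nhds h0, isOpen_ne.mem_nhds h1] with w hw0 hw1
  rw [blochWigner_one_div hw1, neg_neg]

lemma blochWigner_one_sub {z : ℂ} (h0 : z ≠ 0) (h1 : z ≠ 1) :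
    blochWigner (1 - z) = -blochWigner z := by
  have hconst := HasImDerivAt.eq_of_forall_notMem (s := {0, 1})
    (f := fun w => blochWigner (1 - w) + blochWigner w) (by simp) (fun w hw => by
      simp only [Set.mem_insert_iff, Set.mem_singleton_iff, not_or] at hw
      refine (((hasImDerivAt_blochWigner (sub_ne_zero.2 (Ne.symm hw.2)) (by simpa using hw.1)).comp
        ((hasDerivAt_id w).const_sub 1)).add (hasImDerivAt_blochWigner hw.1 hw.2)).congr_deriv ?_
      simp only [blochWignerDeriv, sub_sub_cancel]
      ring)
    (x := z) (y := -1) (by simp [h0, h1]) (by norm_num)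
  have hm1 : blochWigner (-1) = 0 := blochWigner_eq_zero_of_im_eq_zero (by simp) (by norm_num)
  have hm2 : blochWigner (1 - -1) = 0 :=
    blochWigner_eq_zero_of_im_eq_zero (by simp) (by norm_num)
  simp only [hm1, hm2] at hconst
  linarith

/-! ### The five-term relation -/

/-- The five-term combination of values of the Bloch–Wigner function. -/
noncomputable def fiveTerm (x y : ℂ) : ℝ :=
  blochWigner x - blochWigner y + blochWigner (y / x)
    - blochWigner (y * (x - 1) / (x * (y - 1))) + blochWigner ((x - 1) / (y - 1))

lemma hasImDerivAt_fiveTerm {x y : ℂ} (hx0 : x ≠ 0) (hx1 : x ≠ 1) (hy0 : y ≠ 0) (hy1 : y ≠ 1)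
    (hxy : x ≠ y) : HasImDerivAt (fun x => fiveTerm x y) 0 x := by
  have hx1' : x - 1 ≠ 0 := sub_ne_zero.2 hx1
  have hy1' : y - 1 ≠ 0 := sub_ne_zero.2 hy1
  have hxy' : x - y ≠ 0 := sub_ne_zero.2 hxy
  have e3 : 1 - y / x = (x - y) / x := by field_simp
  have e4 : 1 - y * (x - 1) / (x * (y - 1)) = -((x - y) / (x * (y - 1))) := by
    field_simp; ring
  have e5 : 1 - (x - 1) / (y - 1) = -((x - y) / (y - 1)) := by field_simp; ring
  have n3 : y / x ≠ 1 := by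
    intro h; rw [h, sub_self] at e3; exact div_ne_zero hxy' hx0 e3.symm
  have n4 : y * (x - 1) / (x * (y - 1)) ≠ 1 := by
    intro h; rw [h, sub_self] at e4
    exact neg_ne_zero.2 (div_ne_zero hxy' (mul_ne_zero hx0 hy1')) e4.symm
  have n5 : (x - 1) / (y - 1) ≠ 1 := by
    intro h; rw [h, sub_self] at e5
    exact neg_ne_zero.2 (div_ne_zero hxy' hy1') e5.symm
  have d3 : HasDerivAt (fun x => y / x) (-y / x ^ 2) x := by
    refine ((hasDerivAt_const x y).div (hasDerivAt_id x) hx0).congr_deriv ?_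
    simp
  have d4 : HasDerivAt (fun x => y * (x - 1) / (x * (y - 1))) (y / (x ^ 2 * (y - 1))) x := by
    refine ((((hasDerivAt_id x).sub_const 1).const_mul y).div
      ((hasDerivAt_id x).mul_const (y - 1)) (mul_ne_zero hx0 hy1')).congr_deriv ?_
    simp only [id]
    field_simp
    ring
  have d5 : HasDerivAt (fun x => (x - 1) / (y - 1)) (1 / (y - 1)) x :=
    ((hasDerivAt_id x).sub_const 1).div_const (y - 1)
  have h1 := hasImDerivAt_blochWigner hx0 hx1
  have h2 : HasImDerivAt (fun _ => blochWigner y) 0 x := by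
    refine (hasFDerivAt_const (blochWigner y) x).congr_fderiv ?_
    ext
    simp
  have h3 := (hasImDerivAt_blochWigner (div_ne_zero hy0 hx0) n3).comp d3
  have h4 := (hasImDerivAt_blochWigner
    (div_ne_zero (mul_ne_zero hy0 hx1') (mul_ne_zero hx0 hy1')) n4).comp
    (h := fun x => y * (x - 1) / (x * (y - 1))) d4
  have h5 := (hasImDerivAt_blochWigner (div_ne_zero hx1' hy1') n5).comp
    (h := fun x => (x - 1) / (y - 1)) d5
  refine ((((h1.sub h2).add h3).sub h4).add h5).congr_deriv ?_
  have l1 : Real.log ‖1 - x‖ = Real.log ‖x - 1‖ := by rw [norm_sub_rev]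
  simp only [blochWignerDeriv]
  rw [l1, e3, e4, e5]
  simp only [norm_neg, norm_div, norm_mul]
  have a0 := norm_ne_zero_iff.2 hx0
  have a1 := norm_ne_zero_iff.2 hx1'
  have b0 := norm_ne_zero_iff.2 hy0
  have b1 := norm_ne_zero_iff.2 hy1'
  have c0 := norm_ne_zero_iff.2 hxy'
  rw [Real.log_div b0 a0, Real.log_div c0 a0, Real.log_div (mul_ne_zero b0 a1) (mul_ne_zero a0 b1),
    Real.log_div c0 (mul_ne_zero a0 b1), Real.log_div a1 b1, Real.log_div c0 b1,
    Real.log_mul b0 a1, Real.log_mul a0 b1]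
  push_cast
  -- The five logarithms can be treated as indeterminates: the rational coefficient of each one
  -- vanishes.
  generalize (Real.log ‖x‖ : ℂ) = A
  generalize (Real.log ‖x - 1‖ : ℂ) = B
  generalize (Real.log ‖y‖ : ℂ) = C
  generalize (Real.log ‖y - 1‖ : ℂ) = E
  generalize (Real.log ‖x - y‖ : ℂ) = F
  have hx1'' : 1 - x ≠ 0 := sub_ne_zero.2 hx1.symm
  rw [show (1 - x) = -(x - 1) by ring]
  field_simp
  ring

/-- The swap exchanges the first two terms and inverts the arguments of the other three. -/
lemma fiveTerm_swap {x y : ℂ} (hx0 : x ≠ 0) (hx1 : x ≠ 1) (hy1 : y ≠ 1)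
    (hxy : x ≠ y) : fiveTerm y x = -fiveTerm x y := by
  have hx1' : x - 1 ≠ 0 := sub_ne_zero.2 hx1
  have hy1' : y - 1 ≠ 0 := sub_ne_zero.2 hy1
  have n3 : y / x ≠ 1 := by
    rw [Ne, div_eq_one_iff_eq hx0]; exact hxy.symm
  have n4 : y * (x - 1) / (x * (y - 1)) ≠ 1 := by
    rw [Ne, div_eq_one_iff_eq (mul_ne_zero hx0 hy1')]
    intro h
    exact hxy (by linear_combination h)
  have n5 : (x - 1) / (y - 1) ≠ 1 := by
    rw [Ne, div_eq_one_iff_eq hy1']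
    intro h
    exact hxy (by linear_combination h)
  have m3 := blochWigner_one_div n3
  have m4 := blochWigner_one_div n4
  have m5 := blochWigner_one_div n5
  rw [one_div_div] at m3 m4 m5
  rw [fiveTerm, fiveTerm, m3, m4, m5]
  ring

lemma fiveTerm_congr_left {x x' y : ℂ} (hx0 : x ≠ 0) (hx1 : x ≠ 1) (hx0' : x' ≠ 0) (hx1' : x' ≠ 1)
    (hy0 : y ≠ 0) (hy1 : y ≠ 1) (hxy : x ≠ y) (hxy' : x' ≠ y) : fiveTerm x y = fiveTerm x' y := by
  refine HasImDerivAt.eq_of_forall_notMem (s := {0, 1, y}) (f := fun x => fiveTerm x y)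
    (by simp) (fun w hw => ?_) (by simp [*]) (by simp [*])
  simp only [Set.mem_insert_iff, Set.mem_singleton_iff, not_or] at hw
  exact hasImDerivAt_fiveTerm hw.1 hw.2.1 hy0 hy1 hw.2.2

/-- The five-term relation for the Bloch–Wigner function. -/
theorem fiveTerm_eq_zero {x y : ℂ} (hx0 : x ≠ 0) (hx1 : x ≠ 1) (hy0 : y ≠ 0) (hy1 : y ≠ 1)
    (hxy : x ≠ y) : fiveTerm x y = 0 := by
  obtain ⟨z, hz⟩ := Set.Infinite.exists_notMem_finset (s := (Set.univ : Set ℂ))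
    Set.infinite_univ {0, 1, x, y}
  simp only [Finset.mem_insert, Finset.mem_singleton, not_or] at hz
  obtain ⟨-, hz0, hz1, hzx, hzy⟩ := hz
  -- Alternating "change the first argument" with "swap" through a third point `z` leads from `(x,
  -- y)` to `(y, x)` with sign `+`, whereas a direct swap has sign `-`.
  have e1 := fiveTerm_congr_left hx0 hx1 hz0 hz1 hy0 hy1 hxy hzy
  have e2 := fiveTerm_swap hz0 hz1 hy1 hzy
  have e3 := fiveTerm_congr_left hy0 hy1 hx0 hx1 hz0 hz1 (Ne.symm hzy) (Ne.symm hzx)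
  have e4 := fiveTerm_swap hz0 hz1 hx1 hzx
  have e5 := fiveTerm_congr_left hz0 hz1 hy0 hy1 hx0 hx1 hzx (Ne.symm hxy)
  have e6 := fiveTerm_swap hx0 hx1 hy1 hxy
  linarith

lemma blochWigner_one_sub_one_div {z : ℂ} (h0 : z ≠ 0) (h1 : z ≠ 1) :
    blochWigner (1 - 1 / z) = blochWigner z := by
  rw [blochWigner_one_sub (one_div_ne_zero h0) (by simpa using h1), blochWigner_one_div h1, neg_neg]

/-! ### Cross-ratios at a vertex -/

/-- The cross-ratio and edge relations of a family of cross-ratios on the index set `ι`. -/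
structure IsEdgeCompatibleFamily {ι : Type*} (Y : ι → ι → ι → ι → ℂ) : Prop where
  ne_zero : ∀ {i j k l}, [i, j, k, l].Nodup → Y i j k l ≠ 0
  ne_one : ∀ {i j k l}, [i, j, k, l].Nodup → Y i j k l ≠ 1
  inversion : ∀ {i j k l}, [i, j, k, l].Nodup → Y i j l k = 1 / Y i j k l
  similarity : ∀ {i j k l}, [i, j, k, l].Nodup → Y i l j k = 1 - 1 / Y i j k l
  edge : ∀ {i j k l m}, [i, j, k, l, m].Nodup → Y i j k l = Y i j k m * Y i j m l

namespace IsEdgeCompatibleFamily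

variable {ι : Type*} {Y : ι → ι → ι → ι → ℂ} {i j k l m : ι}

lemma blochWigner_swap (hY : IsEdgeCompatibleFamily Y) (h : [i, j, k, l].Nodup) :
    blochWigner (Y i j l k) = -blochWigner (Y i j k l) := by
  rw [hY.inversion h, blochWigner_one_div (hY.ne_one h)]

lemma blochWigner_rotate (hY : IsEdgeCompatibleFamily Y) (h : [i, j, k, l].Nodup) :
    blochWigner (Y i l j k) = blochWigner (Y i j k l) := by
  rw [hY.similarity h, blochWigner_one_sub_one_div (hY.ne_zero h) (hY.ne_one h)]

/-- This form lets the alternating sum of volumes be regrouped by first vertex. -/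
lemma blochWigner_add (hY : IsEdgeCompatibleFamily Y) (h : [i, j, k, l].Nodup) :
    blochWigner (Y i j k l) + blochWigner (Y j i l k) + blochWigner (Y k l i j)
        + blochWigner (Y l k j i) =
      blochWigner (Y i j k l) - blochWigner (Y j i k l) + blochWigner (Y k i j l)
        - blochWigner (Y l i j k) := by
  have h1 : [j, i, k, l].Nodup := by grind
  have h2 : [k, i, j, l].Nodup := by grind
  have h3 : [l, i, j, k].Nodup := by grind
  have h4 : [l, k, i, j].Nodup := by grind
  rw [hY.blochWigner_swap h1, hY.blochWigner_rotate h2, hY.blochWigner_swap h4,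
    hY.blochWigner_rotate h3]
  ring

lemma apply_rotate (hY : IsEdgeCompatibleFamily Y) (h : [i, j, k, l].Nodup) :
    Y i k l j = 1 / (1 - Y i j k l) := by
  have h' : [i, l, j, k].Nodup := by grind
  have h0 := hY.ne_zero h
  have h1 := sub_ne_zero.2 (hY.ne_one h)
  have h1' := sub_ne_zero.2 (hY.ne_one h).symm
  rw [hY.similarity h', hY.similarity h]
  have : 1 - 1 / Y i j k l = (Y i j k l - 1) / Y i j k l := by field_simp
  rw [this]
  field_simp
  ring

/-- With `x = Y i j k l` and `y = Y i j k m`, this lemma and the next give `y / x` and `(1 - y) / (1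
- x)`, matching the arguments of `fiveTerm x y` up to inversion. -/
lemma apply_left (hY : IsEdgeCompatibleFamily Y) (h : [i, j, k, l, m].Nodup) :
    Y i j l m = Y i j k m / Y i j k l := by
  have h1 : [i, j, l, m, k].Nodup := by grind
  have h2 : [i, j, k, l].Nodup := by grind
  rw [hY.edge h1, hY.inversion h2]
  ring

lemma apply_right (hY : IsEdgeCompatibleFamily Y) (h : [i, j, k, l, m].Nodup) :
    Y i k l m = (1 - Y i j k m) / (1 - Y i j k l) := by
  have h1 : [i, k, l, m, j].Nodup := by grind
  have h2 : [i, j, k, l].Nodup := by grind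
  have h3 : [i, j, k, m].Nodup := by grind
  have h4 : [i, k, m, j].Nodup := by grind
  rw [hY.edge h1, hY.apply_rotate h2, hY.inversion h4, hY.apply_rotate h3]
  simp only [one_div, inv_inv]
  ring

lemma left_ne_right (hY : IsEdgeCompatibleFamily Y) (h : [i, j, k, l, m].Nodup) :
    Y i j k l ≠ Y i j k m := by
  intro e
  have h2 : [i, j, k, l].Nodup := by grind
  refine hY.ne_one (i := i) (j := j) (k := l) (l := m) (by grind) ?_
  rw [hY.apply_left h, ← e, div_self (hY.ne_zero h2)]

end IsEdgeCompatibleFamily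

/-! ### Link cross-ratios -/

/-- The cross-ratio of the four directions at the vertex `i` of a five-point configuration. -/
noncomputable def linkCrossRatio {ι : Type*} (Y : ι → ι → ι → ι → ℂ) (i j k l m : ι) : ℂ :=
  Y i j l m / Y i k l m

namespace IsEdgeCompatibleFamily

variable {ι : Type*} {Y : ι → ι → ι → ι → ℂ} {i j k l m : ι}

lemma linkCrossRatio_eq (hY : IsEdgeCompatibleFamily Y) (h : [i, j, k, l, m].Nodup) :
    linkCrossRatio Y i j k l m =
      Y i j k m * (Y i j k l - 1) / (Y i j k l * (Y i j k m - 1)) := by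
  have h2 : [i, j, k, l].Nodup := by grind
  have h3 : [i, j, k, m].Nodup := by grind
  have a0 := hY.ne_zero h2
  have a1 := sub_ne_zero.2 (hY.ne_one h2)
  have a1' := sub_ne_zero.2 (hY.ne_one h2).symm
  have b1 := sub_ne_zero.2 (hY.ne_one h3)
  have b1' := sub_ne_zero.2 (hY.ne_one h3).symm
  rw [linkCrossRatio, hY.apply_left h, hY.apply_right h]
  field_simp
  ring

lemma linkCrossRatio_ne_zero (hY : IsEdgeCompatibleFamily Y) (h : [i, j, k, l, m].Nodup) :
    linkCrossRatio Y i j k l m ≠ 0 :=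
  div_ne_zero (hY.ne_zero (by grind)) (hY.ne_zero (by grind))

lemma linkCrossRatio_ne_one (hY : IsEdgeCompatibleFamily Y) (h : [i, j, k, l, m].Nodup) :
    linkCrossRatio Y i j k l m ≠ 1 := by
  have h2 : [i, j, k, l].Nodup := by grind
  have h3 : [i, j, k, m].Nodup := by grind
  rw [hY.linkCrossRatio_eq h, Ne, div_eq_one_iff_eq
    (mul_ne_zero (hY.ne_zero h2) (sub_ne_zero.2 (hY.ne_one h3)))]
  intro e
  exact hY.left_ne_right h (by linear_combination e)

/-- The five-term relation at the vertex `i`. -/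
lemma blochWigner_linkCrossRatio (hY : IsEdgeCompatibleFamily Y) (h : [i, j, k, l, m].Nodup) :
    blochWigner (linkCrossRatio Y i j k l m) =
      blochWigner (Y i j k l) - blochWigner (Y i j k m) + blochWigner (Y i j l m)
        - blochWigner (Y i k l m) := by
  have h2 : [i, j, k, l].Nodup := by grind
  have h3 : [i, j, k, m].Nodup := by grind
  have h4 : [i, k, l, m].Nodup := by grind
  have key := fiveTerm_eq_zero (hY.ne_zero h2) (hY.ne_one h2) (hY.ne_zero h3) (hY.ne_one h3)
    (hY.left_ne_right h)
  have e : (Y i j k l - 1) / (Y i j k m - 1) = 1 / Y i k l m := by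
    rw [hY.apply_right h, one_div_div, ← neg_sub, ← neg_sub (1 : ℂ) (Y i j k m), neg_div_neg_eq]
  rw [fiveTerm, ← hY.apply_left h, ← hY.linkCrossRatio_eq h, e,
    blochWigner_one_div (hY.ne_one h4)] at key
  linarith

/-- Together with the next two lemmas, this reduces the link cross-ratios in the face relations to
one per vertex. -/
lemma linkCrossRatio_swap_right (hY : IsEdgeCompatibleFamily Y) (h : [i, j, k, l, m].Nodup) :
    linkCrossRatio Y i j k m l = 1 / linkCrossRatio Y i j k l m := by
  have h1 : [i, j, l, m].Nodup := by grind
  have h2 : [i, k, l, m].Nodup := by grind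
  rw [linkCrossRatio, linkCrossRatio, hY.inversion h1, hY.inversion h2]
  simp [div_eq_mul_inv, mul_comm]

lemma linkCrossRatio_swap_mid (hY : IsEdgeCompatibleFamily Y) (h : [i, j, k, l, m].Nodup) :
    1 / linkCrossRatio Y i j l k m = 1 - 1 / linkCrossRatio Y i j k l m := by
  have h' : [i, j, l, k, m].Nodup := by grind
  have h2 : [i, j, k, l].Nodup := by grind
  have h3 : [i, j, k, m].Nodup := by grind
  have a0 := hY.ne_zero h2
  have b0 := hY.ne_zero h3
  have a1 := sub_ne_zero.2 (hY.ne_one h2)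
  rw [hY.linkCrossRatio_eq h', hY.linkCrossRatio_eq h, hY.inversion h2, hY.apply_left h]
  have a1' := sub_ne_zero.2 (hY.ne_one h2).symm
  generalize Y i j k l = x at *
  generalize Y i j k m = y at *
  have e : 1 / x - 1 = (1 - x) / x := by field_simp
  rw [e]
  field_simp
  ring

lemma linkCrossRatio_rotate (hY : IsEdgeCompatibleFamily Y) (h : [i, j, k, l, m].Nodup) :
    1 / linkCrossRatio Y i k l j m = 1 - linkCrossRatio Y i j k l m := by
  have h' : [i, k, l, j, m].Nodup := by grind
  have h2 : [i, j, k, l].Nodup := by grind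
  have h3 : [i, j, k, m].Nodup := by grind
  have a0 := hY.ne_zero h2
  have b1 := sub_ne_zero.2 (hY.ne_one h3)
  have b1' := sub_ne_zero.2 (hY.ne_one h3).symm
  have a1 := sub_ne_zero.2 (hY.ne_one h2)
  have a1' := sub_ne_zero.2 (hY.ne_one h2).symm
  rw [hY.linkCrossRatio_eq h', hY.linkCrossRatio_eq h, hY.apply_rotate h2, hY.apply_right h]
  generalize Y i j k l = x at *
  generalize Y i j k m = y at *
  have e : 1 / (1 - x) - 1 = x / (1 - x) := by field_simp; ring
  rw [e]
  field_simp
  ring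

/-- Each factor is the quotient of corresponding factors on the two sides of face compatibility. -/
lemma linkCrossRatio_mul_eq_one (hY : IsEdgeCompatibleFamily Y) (h : [i, j, k, l, m].Nodup)
    (hface : Y i j k l * Y l j i k * Y k j l i = Y i m k l * Y l m i k * Y k m l i) :
    linkCrossRatio Y i j m k l * linkCrossRatio Y l j m i k * linkCrossRatio Y k j m l i = 1 := by
  have h1 := hY.ne_zero (i := i) (j := m) (k := k) (l := l) (by grind)
  have h2 := hY.ne_zero (i := l) (j := m) (k := i) (l := k) (by grind)
  have h3 := hY.ne_zero (i := k) (j := m) (k := l) (l := i) (by grind)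
  simp only [linkCrossRatio]
  field_simp
  exact hface

end IsEdgeCompatibleFamily

/-! ### Assembly for five points -/

lemma IsCrossRatioStructure.isEdgeCompatibleFamily {P : Type*} {p : Fin 5 → P}
    (hp : Function.Injective p) {X : P → P → P → P → ℂ}
    (hX : ∀ Δ : Set P, Δ ⊆ Set.range p → Δ.ncard = 4 → IsCrossRatioStructure Δ X)
    (hedge : EdgeCompatible p X) :
    IsEdgeCompatibleFamily fun i j k l => X (p i) (p j) (p k) (p l) := by
  have hnd : ∀ {i j k l : Fin 5}, [i, j, k, l].Nodup → [p i, p j, p k, p l].Nodup :=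
    fun h => h.map hp
  have hS : ∀ {i j k l : Fin 5}, [i, j, k, l].Nodup →
      IsCrossRatioStructure {p i, p j, p k, p l} X := by
    intro i j k l h
    refine hX _ ?_ ?_
    · rintro _ (rfl | rfl | rfl | rfl) <;> exact Set.mem_range_self _
    · classical
      have h' := List.toFinset_card_of_nodup (hnd h)
      rw [← Set.ncard_coe_finset] at h'
      simpa using h'
  have hO : ∀ {i j k l : Fin 5}, [i, j, k, l].Nodup →
      IsOrderingOf {p i, p j, p k, p l} (p i) (p j) (p k) (p l) := fun h => ⟨hnd h, rfl⟩
  refine ⟨fun h => (hS h).ne_zero _ _ _ _ (hO h), fun h => (hS h).ne_one _ _ _ _ (hO h),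
    fun {i j k l} h => ?_, fun {i j k l} h => ?_, fun h => hedge _ _ _ _ _ h⟩
  · have h' : [i, j, l, k].Nodup := by grind
    exact (hS h').inversion _ _ _ _ (hO h')
  · have e := (hS h).similarity _ _ _ _ (hO h)
    rw [e]
    simp

theorem mainTheorem1 {P : Type*} (p : Fin 5 → P) (hp : Function.Injective p)
    (X : P → P → P → P → ℂ)
    (hX : ∀ Δ : Set P, Δ ⊆ Set.range p → Δ.ncard = 4 → IsCrossRatioStructure Δ X)
    (hedge : EdgeCompatible p X) (hface : FaceCompatible p X) :
    simplexVolume X (p 0) (p 1) (p 2) (p 3) - simplexVolume X (p 0) (p 1) (p 2) (p 4)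
      + simplexVolume X (p 0) (p 1) (p 3) (p 4) - simplexVolume X (p 0) (p 2) (p 3) (p 4)
      + simplexVolume X (p 1) (p 2) (p 3) (p 4) = 0 := by
  have hY := IsCrossRatioStructure.isEdgeCompatibleFamily hp hX hedge
  set Y : Fin 5 → Fin 5 → Fin 5 → Fin 5 → ℂ := fun i j k l => X (p i) (p j) (p k) (p l)
  have vol : ∀ {i j k l : Fin 5}, [i, j, k, l].Nodup → simplexVolume X (p i) (p j) (p k) (p l) =
      blochWigner (Y i j k l) - blochWigner (Y j i k l) + blochWigner (Y k i j l)
        - blochWigner (Y l i j k) := fun h => hY.blochWigner_add h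
  have face : ∀ {i j k l m : Fin 5}, [i, j, k, l, m].Nodup →
      linkCrossRatio Y i j m k l * linkCrossRatio Y l j m i k * linkCrossRatio Y k j m l i = 1 :=
    fun h => hY.linkCrossRatio_mul_eq_one h (hface _ _ _ _ _ h)
  rw [vol (by decide), vol (by decide), vol (by decide), vol (by decide), vol (by decide)]
  have n0 : [(0 : Fin 5), 1, 2, 3, 4].Nodup := by decide
  have n1 : [(1 : Fin 5), 0, 2, 3, 4].Nodup := by decide
  have n2 : [(2 : Fin 5), 0, 1, 3, 4].Nodup := by decide
  have n3 : [(3 : Fin 5), 0, 1, 2, 4].Nodup := by decide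
  have n4 : [(4 : Fin 5), 0, 1, 2, 3].Nodup := by decide
  -- These are the three faces containing the edge `34`; each ties one of `r0, r1, r2` to `r3` and
  -- `r4`.
  have f0 := face (i := 3) (j := 1) (m := 2) (k := 4) (l := 0) (by decide)
  have f1 := face (i := 3) (j := 0) (m := 2) (k := 4) (l := 1) (by decide)
  have f2 := face (i := 3) (j := 0) (m := 1) (k := 4) (l := 2) (by decide)
  have s3 := hY.linkCrossRatio_rotate n3
  have s4 := hY.linkCrossRatio_rotate n4
  have t3 := hY.linkCrossRatio_swap_mid n3
  have t4 := hY.linkCrossRatio_swap_mid n4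
  rw [hY.linkCrossRatio_swap_right (i := 3) (l := 0) (by decide), s3] at f0
  rw [hY.linkCrossRatio_swap_right (i := 3) (l := 1) (by decide), t3] at f1
  rw [hY.linkCrossRatio_swap_right n3] at f2
  rw [one_div, inv_eq_iff_eq_inv] at s4 t4
  rw [s4] at f0
  rw [t4] at f1
  have R0 := hY.linkCrossRatio_ne_one n0
  have R3 := hY.linkCrossRatio_ne_zero n3
  have R3' := hY.linkCrossRatio_ne_one n3
  have R4 := hY.linkCrossRatio_ne_zero n4
  have R4' := hY.linkCrossRatio_ne_one n4
  have D0 := hY.blochWigner_linkCrossRatio n0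
  have D1 := hY.blochWigner_linkCrossRatio n1
  have D2 := hY.blochWigner_linkCrossRatio n2
  have D3 := hY.blochWigner_linkCrossRatio n3
  have D4 := hY.blochWigner_linkCrossRatio n4
  generalize linkCrossRatio Y 0 1 2 3 4 = r0 at *
  generalize linkCrossRatio Y 1 0 2 3 4 = r1 at *
  generalize linkCrossRatio Y 2 0 1 3 4 = r2 at *
  generalize linkCrossRatio Y 3 0 1 2 4 = r3 at *
  generalize linkCrossRatio Y 4 0 1 2 3 = r4 at *
  have u3 := sub_ne_zero.2 R3'
  have u3' := sub_ne_zero.2 R3'.symm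
  have u4 := sub_ne_zero.2 R4'
  have u4' := sub_ne_zero.2 R4'.symm
  have e0 : r0 = (r4 - 1) / (r3 - 1) := by
    field_simp at f0 ⊢
    linear_combination -f0
  have e1 : r1 = r3 * (r4 - 1) / (r4 * (r3 - 1)) := by
    have e : 1 - 1 / r4 = (r4 - 1) / r4 := by field_simp
    rw [e] at f1
    field_simp at f1 ⊢
    linear_combination f1
  have e2 : r2 = r3 / r4 := by
    field_simp at f2 ⊢
    linear_combination f2
  -- Equality would force `r0 = 1`.
  have hne : r4 ≠ r3 := by
    rintro rfl
    exact R0 (by rw [e0, div_self u4])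
  have key := fiveTerm_eq_zero R4 R4' R3 R3' hne
  rw [fiveTerm, ← e0, ← e1, ← e2] at key
  -- The alternating sum of volumes is `D0 - D1 + D2 - D3 + D4`, which equals `fiveTerm r4 r3`.
  linarith
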